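/- Let $d\ge 1$ be an integer, $\mathbb T^d=\mathbb R^d/\mathbb Z^d$ with its Haar probability measure $dx$, $\widehat f(k)=\int_{\mathbb T^d} f(x)e^{-2\pi i k\cdot x}\,dx$ for $k\in\mathbb Z^d$, and let $|k|$ be the Euclidean norm. For $s>0$ and $t>0$, the operators $\Lambda^s$ and $e^{-t\Lambda^s}$ on $\mathbb T^d$ are the Fourier multipliers with symbols $|k|^s$ and $e^{-t|k|^s}$. Fix a real-valued $\psi\in C_c^\infty(\mathbb R^d)$ with $\psi(\xi)=1$ for $|\xi|\le 1$ and $\psi(\xi)=0$ for $|\xi|\ge 1.01$, and for integers $N\ge 2$ let $P_N$ be the Fourier multiplier on $\mathbb T^d$ with symbol $\psi(k/(2N))-\psi(k/N)$. Write $\|\cdot\|_p$ for the norm of $L^p(\mathbb T^d)$. Theorem. Let $0<s\le 2$ and $1<p<\infty$. There is a constant $c>0$ depending only on $(p,s,d,\psi)$ such that for every smooth $f:\mathbb T^d\to\mathbb R$ and every integer $N\ge 2$, $$\|e^{-t\Lambda^s}P_Nf\|_p\le e^{-cN^st}\,\|P_Nf\|_p\qquad\text{for all } t>0.$$ Moreover,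 there is a constant $\tilde c>0$ depending only on $(p,s,d,\psi)$ such that for every smooth $f:\mathbb T^d\to\mathbb R$ and every integer $N\ge 2$, $$\operatorname{Re}\int_{\mathbb T^d}(\Lambda^sP_Nf)\,|P_Nf|^{p-2}\,\overline{P_Nf}\,dx\ \ge\ \tilde c\,N^s\,\|P_Nf\|_p^p .$$ When $P_Nf$ is real-valued (for example whenever $\psi$ is even), the left-hand side is $\int_{\mathbb T^d}(\Lambda^sP_Nf)\,|P_Nf|^{p-2}P_Nf\,dx$. -/

import Mathlib

open MeasureTheory UnitAddTorus
open scoped ContDiff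

noncomputable section

/-- The Haar probability measure `dx` on `𝕋ᵈ = ℝᵈ/ℤᵈ` (the product of the normalized Haar measures
on the factors), with respect to which Mathlib's `mFourierCoeff` is also defined. -/
def torusMeasure (d : ℕ) : Measure (UnitAddTorus (Fin d)) :=
  Measure.pi (fun _ => AddCircle.haarAddCircle)

/-- The frequency `k ∈ ℤᵈ`, as a vector of the Euclidean space `ℝᵈ`; thus `‖freq k‖ = |k|`. -/
def freq {d : ℕ} (k : Fin d → ℤ) : EuclideanSpace ℝ (Fin d) :=
  WithLp.toLp 2 (fun i => (k i : ℝ))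

/-- `f : 𝕋ᵈ → ℝ` is smooth, i.e. its `ℤᵈ`-periodic lift to `ℝᵈ` is `C^∞`. -/
def TorusSmooth {d : ℕ} (f : UnitAddTorus (Fin d) → ℝ) : Prop :=
  ContDiff ℝ ∞ (fun x : EuclideanSpace ℝ (Fin d) => f (fun i => (x i : UnitAddCircle)))

/-- The Fourier multiplier operator on `𝕋ᵈ = ℝᵈ/ℤᵈ` with symbol `m`:
`f ↦ ∑ₖ m(k) f̂(k) e^{2πi k·x}`, where `f̂(k) = ∫ f(x) e^{-2πi k·x} dx`. -/
def torusMultiplier {d : ℕ} (m : (Fin d → ℤ) → ℂ) (f : UnitAddTorus (Fin d) → ℂ) :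
    UnitAddTorus (Fin d) → ℂ :=
  fun x => ∑' k : Fin d → ℤ, m k * mFourierCoeff f k * mFourier k x

/-- The fractional Laplacian `Λ^s` on `𝕋ᵈ`, with symbol `|k|^s`. -/
def fracLaplacian {d : ℕ} (s : ℝ) (f : UnitAddTorus (Fin d) → ℂ) : UnitAddTorus (Fin d) → ℂ :=
  torusMultiplier (fun k => ((‖freq k‖ ^ s : ℝ) : ℂ)) f

/-- The semigroup `e^{-tΛ^s}` on `𝕋ᵈ`, with symbol `e^{-t|k|^s}`. -/
def fracHeat {d : ℕ} (s t : ℝ) (f : UnitAddTorus (Fin d) → ℂ) : UnitAddTorus (Fin d) → ℂ :=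
  torusMultiplier (fun k => ((Real.exp (-t * ‖freq k‖ ^ s) : ℝ) : ℂ)) f

/-- `ψ ∈ C_c^∞(ℝᵈ)` with `ψ = 1` on `|ξ| ≤ 1` and `ψ = 0` on `|ξ| ≥ 1.01`. -/
structure IsLPCutoff {d : ℕ} (ψ : EuclideanSpace ℝ (Fin d) → ℝ) : Prop where
  smooth : ContDiff ℝ ∞ ψ
  hasCompactSupport : HasCompactSupport ψ
  eq_one : ∀ ξ, ‖ξ‖ ≤ 1 → ψ ξ = 1
  eq_zero : ∀ ξ, 1.01 ≤ ‖ξ‖ → ψ ξ = 0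

/-- The Littlewood–Paley projection `P_N` on `𝕋ᵈ`, with symbol `ψ(k/(2N)) - ψ(k/N)`. -/
def lpProj {d : ℕ} (ψ : EuclideanSpace ℝ (Fin d) → ℝ) (N : ℕ) (f : UnitAddTorus (Fin d) → ℂ) :
    UnitAddTorus (Fin d) → ℂ :=
  torusMultiplier
    (fun k => ((ψ ((2 * (N : ℝ))⁻¹ • freq k) - ψ ((N : ℝ)⁻¹ • freq k) : ℝ) : ℂ)) f

end

noncomputable section

open ComplexConjugate Filter Topology
open scoped FourierTransform SchwartzMap

/-- The map `z ↦ |z|^{p-2} z̄`, which sends `L^p` to its dual. -/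
def dualMap (p : ℝ) (z : ℂ) : ℂ := ((‖z‖ ^ (p - 2) : ℝ) : ℂ) * conj z

lemma rpow_sub_two_mul_self {p x : ℝ} (hp : 1 < p) (hx : 0 ≤ x) :
    x ^ (p - 2) * x = x ^ (p - 1) := by
  rcases hx.eq_or_lt with rfl | hx
  · rw [mul_zero, Real.zero_rpow (by linarith)]
  · rw [← Real.rpow_add_one hx.ne']
    congr 1
    ring

lemma rpow_sub_one_mul_self {p x : ℝ} (hp : 1 < p) (hx : 0 ≤ x) :
    x ^ (p - 1) * x = x ^ p := by
  rcases hx.eq_or_lt with rfl | hx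
  · rw [mul_zero, Real.zero_rpow (by linarith)]
  · rw [← Real.rpow_add_one hx.ne']
    congr 1
    ring

lemma norm_dualMap {p : ℝ} (hp : 1 < p) (z : ℂ) : ‖dualMap p z‖ = ‖z‖ ^ (p - 1) := by
  rw [dualMap, norm_mul, Complex.norm_real, RCLike.norm_conj,
    Real.norm_of_nonneg (by positivity), rpow_sub_two_mul_self hp (norm_nonneg z)]

lemma mul_dualMap {p : ℝ} (hp : 1 < p) (z : ℂ) : z * dualMap p z = ((‖z‖ ^ p : ℝ) : ℂ) := by
  have h : z * conj z = ((‖z‖ * ‖z‖ : ℝ) : ℂ) := by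
    rw [Complex.mul_conj, Complex.normSq_eq_norm_sq, sq]
  rw [dualMap, mul_left_comm, h, ← Complex.ofReal_mul, ← mul_assoc,
    rpow_sub_two_mul_self hp (norm_nonneg z), rpow_sub_one_mul_self hp (norm_nonneg z)]

lemma continuous_dualMap {p : ℝ} (hp : 1 < p) : Continuous (dualMap p) := by
  rw [continuous_iff_continuousAt]
  intro z
  rcases eq_or_ne z 0 with rfl | hz
  · have h0 : dualMap p 0 = 0 := by simp [dualMap]
    rw [ContinuousAt, h0, tendsto_zero_iff_norm_tendsto_zero]
    simp_rw [norm_dualMap hp]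
    have : ContinuousAt (fun w : ℂ => ‖w‖ ^ (p - 1)) 0 :=
      continuous_norm.continuousAt.rpow_const (Or.inr (by linarith))
    simpa [ContinuousAt, Real.zero_rpow (by linarith : p - 1 ≠ 0)] using this
  · unfold dualMap
    refine ContinuousAt.mul ?_ Complex.continuous_conj.continuousAt
    exact Complex.continuous_ofReal.continuousAt.comp
      (continuous_norm.continuousAt.rpow_const (Or.inl (norm_ne_zero_iff.2 hz)))

lemma mul_sub_le_rpow_sub_rpow {θ x y : ℝ} (h0 : 0 < θ) (h1 : θ ≤ 1) (hy : 0 ≤ y) (hyx : y ≤ x) :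
    θ * (x - y) ≤ (x + y) ^ (1 - θ) * (x ^ θ - y ^ θ) := by
  rcases (hy.trans hyx).eq_or_lt with h | hx
  · obtain rfl : x = 0 := h.symm
    obtain rfl : y = 0 := le_antisymm hyx hy
    simp
  have hb := rpow_one_add_le_one_add_mul_self (s := y / x - 1)
    (by linarith [div_nonneg hy hx.le]) h0.le h1
  rw [add_sub_cancel, Real.div_rpow hy hx.le, div_le_iff₀ (by positivity)] at hb
  have hd : 0 ≤ x ^ θ - y ^ θ := sub_nonneg.2 (Real.rpow_le_rpow hy hyx h0.le)
  calc θ * (x - y) = x ^ (1 - θ) * (x ^ θ * (θ * (1 - y / x))) := by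
        rw [← mul_assoc, ← Real.rpow_add hx, sub_add_cancel, Real.rpow_one]
        field_simp
    _ ≤ x ^ (1 - θ) * (x ^ θ - y ^ θ) := by
        gcongr
        linarith
    _ ≤ (x + y) ^ (1 - θ) * (x ^ θ - y ^ θ) := by
        gcongr
        · linarith

lemma rpow_sub_rpow_le_mul_sub {θ x y : ℝ} (h1 : 1 ≤ θ) (hy : 0 ≤ y) (hyx : y ≤ x) :
    x ^ θ - y ^ θ ≤ θ * (x + y) ^ (θ - 1) * (x - y) := by
  rcases (hy.trans hyx).eq_or_lt with h | hx
  · obtain rfl : x = 0 := h.symm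
    obtain rfl : y = 0 := le_antisymm hyx hy
    simp
  have hb := one_add_mul_self_le_rpow_one_add (s := y / x - 1)
    (by linarith [div_nonneg hy hx.le]) h1
  rw [add_sub_cancel, Real.div_rpow hy hx.le, le_div_iff₀ (by positivity)] at hb
  calc x ^ θ - y ^ θ ≤ x ^ θ * (θ * (1 - y / x)) := by linarith
    _ = θ * x ^ (θ - 1) * (x - y) := by
        rw [Real.rpow_sub_one hx.ne']
        field_simp
    _ ≤ θ * (x + y) ^ (θ - 1) * (x - y) := by
        have : 0 ≤ x - y := by linarith
        gcongr
        · linarith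

lemma affine_nonneg {A B c r : ℝ} (hc : |c| ≤ r) (h1 : 0 ≤ A + B * r) (h2 : 0 ≤ A - B * r) :
    0 ≤ A + B * c := by
  have h3 : |B * c| ≤ |B| * r := by
    rw [abs_mul]
    gcongr
  have h4 : |B| * r ≤ A := by
    rcases abs_cases B with ⟨h, -⟩ | ⟨h, -⟩ <;> rw [h] <;> linarith
  linarith [neg_abs_le (B * c)]

/-- The monotonicity form `Re (a - b)(J a - J b)` of the duality map `J = dualMap p`. -/
def monoForm (p : ℝ) (a b : ℂ) : ℝ := ((a - b) * (dualMap p a - dualMap p b)).re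

lemma monoForm_eq (p : ℝ) (a b : ℂ) :
    monoForm p a b = ‖a‖ ^ (p - 2) * ‖a‖ * ‖a‖ + ‖b‖ ^ (p - 2) * ‖b‖ * ‖b‖ +
      -(‖a‖ ^ (p - 2) + ‖b‖ ^ (p - 2)) * (a * conj b).re := by
  have ha : ‖a‖ * ‖a‖ = a.re * a.re + a.im * a.im := Complex.norm_mul_self_eq_normSq a
  have hb : ‖b‖ * ‖b‖ = b.re * b.re + b.im * b.im := Complex.norm_mul_self_eq_normSq b
  rw [mul_assoc, mul_assoc, ha, hb]
  simp [monoForm, dualMap]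
  ring

lemma norm_sub_sq_eq (a b : ℂ) :
    ‖a - b‖ ^ 2 = ‖a‖ * ‖a‖ + ‖b‖ * ‖b‖ + -2 * (a * conj b).re := by
  rw [← Complex.normSq_eq_norm_sq, Complex.norm_mul_self_eq_normSq,
    Complex.norm_mul_self_eq_normSq]
  simp [Complex.normSq_apply]
  ring

lemma norm_dualMap_sub_sq_eq (p : ℝ) (a b : ℂ) :
    ‖dualMap p a - dualMap p b‖ ^ 2 =
      (‖a‖ ^ (p - 2)) ^ 2 * (‖a‖ * ‖a‖) + (‖b‖ ^ (p - 2)) ^ 2 * (‖b‖ * ‖b‖) +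
        -(2 * (‖a‖ ^ (p - 2) * ‖b‖ ^ (p - 2))) * (a * conj b).re := by
  rw [← Complex.normSq_eq_norm_sq, Complex.norm_mul_self_eq_normSq,
    Complex.norm_mul_self_eq_normSq]
  simp [Complex.normSq_apply, dualMap]
  ring

lemma abs_re_mul_conj_le (a b : ℂ) : |(a * conj b).re| ≤ ‖a‖ * ‖b‖ := by
  simpa using Complex.abs_re_le_norm (a * conj b)

lemma monoForm_nonneg {p : ℝ} (hp : 1 < p) (a b : ℂ) : 0 ≤ monoForm p a b := by
  rw [monoForm_eq]
  have hx := norm_nonneg a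
  have hy := norm_nonneg b
  have hX := rpow_sub_two_mul_self hp hx
  have hY := rpow_sub_two_mul_self hp hy
  refine affine_nonneg (abs_re_mul_conj_le a b) ?_ ?_
  · have : 0 ≤ (‖a‖ - ‖b‖) * (‖a‖ ^ (p - 1) - ‖b‖ ^ (p - 1)) := by
      rcases le_total ‖a‖ ‖b‖ with h | h
      · exact mul_nonneg_of_nonpos_of_nonpos (by linarith)
          (sub_nonpos.2 (Real.rpow_le_rpow hx h (by linarith)))
      · exact mul_nonneg (by linarith) (sub_nonneg.2 (Real.rpow_le_rpow hy h (by linarith)))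
    rw [← hX, ← hY] at this
    linarith
  · have : 0 ≤ (‖a‖ + ‖b‖) * (‖a‖ ^ (p - 2) * ‖a‖ + ‖b‖ ^ (p - 2) * ‖b‖) := by positivity
    linarith

lemma norm_sub_sq_le_monoForm {p : ℝ} (hp : 1 < p) (hp2 : p ≤ 2) (a b : ℂ) :
    (p - 1) * ‖a - b‖ ^ 2 ≤ (‖a‖ + ‖b‖) ^ (2 - p) * monoForm p a b := by
  rw [← sub_nonneg, monoForm_eq, norm_sub_sq_eq]
  have hx := norm_nonneg a
  have hy := norm_nonneg b
  have hX := rpow_sub_two_mul_self hp hx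
  have hY := rpow_sub_two_mul_self hp hy
  have hc := abs_re_mul_conj_le a b
  set c := (a * conj b).re
  set x := ‖a‖
  set y := ‖b‖
  set X := x ^ (p - 2)
  set Y := y ^ (p - 2)
  have key := affine_nonneg (A := (x + y) ^ (2 - p) * (X * x * x + Y * y * y)
    - (p - 1) * (x * x + y * y)) (B := 2 * (p - 1) - (x + y) ^ (2 - p) * (X + Y)) hc ?_ ?_
  · linarith
  · have h : (p - 1) * ((x - y) * (x - y)) ≤
        (x + y) ^ (2 - p) * ((x - y) * (X * x - Y * y)) := by
      rw [hX, hY]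
      rcases le_total x y with h | h
      · have := mul_sub_le_rpow_sub_rpow (θ := p - 1) (by linarith) (by linarith) hx h
        rw [show 1 - (p - 1) = 2 - p by ring, add_comm y x] at this
        nlinarith [mul_le_mul_of_nonneg_left this (sub_nonneg.2 h)]
      · have := mul_sub_le_rpow_sub_rpow (θ := p - 1) (by linarith) (by linarith) hy h
        rw [show 1 - (p - 1) = 2 - p by ring] at this
        nlinarith [mul_le_mul_of_nonneg_left this (sub_nonneg.2 h)]
    linarith
  · have h : (p - 1) * ((x + y) * (x + y)) ≤
        (x + y) ^ (2 - p) * ((x + y) * (X * x + Y * y)) := by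
      rw [hX, hY]
      have h1 : (x + y) ^ (p - 1) ≤ x ^ (p - 1) + y ^ (p - 1) :=
        Real.rpow_add_le_add_rpow hx hy (by linarith) (by linarith)
      rcases (add_nonneg hx hy).eq_or_lt with h0 | h0
      · simp [← h0]
      have h2 : x + y = (x + y) ^ (2 - p) * (x + y) ^ (p - 1) := by
        rw [← Real.rpow_add h0, show 2 - p + (p - 1) = 1 by ring, Real.rpow_one]
      calc (p - 1) * ((x + y) * (x + y)) ≤ 1 * ((x + y) * (x + y)) := by
            gcongr
            linarith
        _ = (x + y) * ((x + y) ^ (2 - p) * (x + y) ^ (p - 1)) := by rw [← h2, one_mul]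
        _ ≤ (x + y) * ((x + y) ^ (2 - p) * (x ^ (p - 1) + y ^ (p - 1))) := by gcongr
        _ = _ := by ring
    linarith

lemma norm_dualMap_sub_sq_le_monoForm {p : ℝ} (hp2 : 2 ≤ p) (a b : ℂ) :
    ‖dualMap p a - dualMap p b‖ ^ 2 ≤ (p - 1) * (‖a‖ + ‖b‖) ^ (p - 2) * monoForm p a b := by
  have hp : 1 < p := by linarith
  rw [← sub_nonneg, monoForm_eq, norm_dualMap_sub_sq_eq]
  have hx := norm_nonneg a
  have hy := norm_nonneg b
  have hX := rpow_sub_two_mul_self hp hx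
  have hY := rpow_sub_two_mul_self hp hy
  have hc := abs_re_mul_conj_le a b
  set c := (a * conj b).re
  set x := ‖a‖
  set y := ‖b‖
  set X := x ^ (p - 2)
  set Y := y ^ (p - 2)
  have key := affine_nonneg (A := (p - 1) * (x + y) ^ (p - 2) * (X * x * x + Y * y * y)
    - (X ^ 2 * (x * x) + Y ^ 2 * (y * y)))
    (B := 2 * (X * Y) - (p - 1) * (x + y) ^ (p - 2) * (X + Y)) hc ?_ ?_
  · linarith
  · have h : (X * x - Y * y) * (X * x - Y * y) ≤
        (p - 1) * (x + y) ^ (p - 2) * ((x - y) * (X * x - Y * y)) := by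
      rw [hX, hY]
      rcases le_total x y with h | h
      · have := rpow_sub_rpow_le_mul_sub (θ := p - 1) (by linarith) hx h
        rw [show p - 1 - 1 = p - 2 by ring, add_comm y x] at this
        nlinarith [mul_le_mul_of_nonneg_left this
          (sub_nonneg.2 (Real.rpow_le_rpow hx h (by linarith : 0 ≤ p - 1)))]
      · have := rpow_sub_rpow_le_mul_sub (θ := p - 1) (by linarith) hy h
        rw [show p - 1 - 1 = p - 2 by ring] at this
        nlinarith [mul_le_mul_of_nonneg_left this
          (sub_nonneg.2 (Real.rpow_le_rpow hy h (by linarith : 0 ≤ p - 1)))]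
    linarith
  · have h : (X * x + Y * y) * (X * x + Y * y) ≤
        (p - 1) * (x + y) ^ (p - 2) * ((x + y) * (X * x + Y * y)) := by
      rw [hX, hY]
      have h1 : x ^ (p - 1) + y ^ (p - 1) ≤ (x + y) ^ (p - 1) :=
        Real.add_rpow_le_rpow_add hx hy (by linarith)
      rw [← rpow_sub_two_mul_self hp (add_nonneg hx hy)] at h1
      calc (x ^ (p - 1) + y ^ (p - 1)) * (x ^ (p - 1) + y ^ (p - 1))
          ≤ (1 * ((x + y) ^ (p - 2) * (x + y))) * (x ^ (p - 1) + y ^ (p - 1)) := by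
            rw [one_mul]
            gcongr
        _ ≤ ((p - 1) * ((x + y) ^ (p - 2) * (x + y))) * (x ^ (p - 1) + y ^ (p - 1)) := by
            gcongr
            linarith
        _ = _ := by ring
    linarith

instance instIsProbabilityMeasureTorusMeasure (d : ℕ) : IsProbabilityMeasure (torusMeasure d) := by
  unfold torusMeasure
  infer_instance

instance instIsAddLeftInvariantTorusMeasure (d : ℕ) :
    Measure.IsAddLeftInvariant (torusMeasure d) := by
  unfold torusMeasure
  infer_instance

lemma Continuous.integrable_of_compactSpace {X E : Type*} [TopologicalSpace X] [CompactSpace X]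
    [MeasurableSpace X] [OpensMeasurableSpace X] {μ : Measure X} [IsFiniteMeasure μ]
    [NormedAddCommGroup E] {f : X → E} (hf : Continuous f) : Integrable f μ :=
  hf.integrable_of_hasCompactSupport (HasCompactSupport.of_compactSpace f)

/-- **Hölder's inequality** for several continuous functions, in terms of weights of sum one. -/
lemma integral_prod_rpow_le {X ι : Type*} [TopologicalSpace X] [CompactSpace X]
    [MeasurableSpace X] [OpensMeasurableSpace X] {μ : Measure X} [IsFiniteMeasure μ]
    (s : Finset ι) {f : ι → X → ℝ} {w : ι → ℝ} (hf : ∀ i ∈ s, Continuous (f i))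
    (h0 : ∀ i ∈ s, ∀ x, 0 ≤ f i x) (hw : ∀ i ∈ s, 0 ≤ w i) (hw1 : ∑ i ∈ s, w i = 1) :
    ∫ x, ∏ i ∈ s, f i x ^ w i ∂μ ≤ ∏ i ∈ s, (∫ x, f i x ∂μ) ^ w i := by
  have hI : ∀ i ∈ s, 0 ≤ ∫ x, f i x ∂μ := fun i hi => integral_nonneg (h0 i hi)
  rw [← ENNReal.ofReal_le_ofReal_iff
      (Finset.prod_nonneg fun i hi => Real.rpow_nonneg (hI i hi) _),
    ofReal_integral_eq_lintegral_ofReal]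
  · have h := ENNReal.lintegral_prod_norm_pow_le (μ := μ) s
      (f := fun i x => ENNReal.ofReal (f i x))
      (fun i hi => (hf i hi).measurable.ennreal_ofReal.aemeasurable) hw1 hw
    calc ∫⁻ x, ENNReal.ofReal (∏ i ∈ s, f i x ^ w i) ∂μ
        = ∫⁻ x, ∏ i ∈ s, ENNReal.ofReal (f i x) ^ w i ∂μ := by
          refine lintegral_congr fun x => ?_
          rw [ENNReal.ofReal_prod_of_nonneg fun i hi => Real.rpow_nonneg (h0 i hi x) _]
          exact Finset.prod_congr rfl fun i hi =>
            (ENNReal.ofReal_rpow_of_nonneg (h0 i hi x) (hw i hi)).symm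
      _ ≤ _ := h
      _ = ENNReal.ofReal (∏ i ∈ s, (∫ x, f i x ∂μ) ^ w i) := by
          rw [ENNReal.ofReal_prod_of_nonneg fun i hi => Real.rpow_nonneg (hI i hi) _]
          refine Finset.prod_congr rfl fun i hi => ?_
          rw [← ENNReal.ofReal_rpow_of_nonneg (hI i hi) (hw i hi),
            ofReal_integral_eq_lintegral_ofReal (hf i hi).integrable_of_compactSpace
              (Filter.Eventually.of_forall (h0 i hi))]
  · exact (continuous_finsetProd _ fun i hi =>
      (hf i hi).rpow_const fun _ => Or.inr (hw i hi)).integrable_of_compactSpace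
  · exact Filter.Eventually.of_forall fun x =>
      Finset.prod_nonneg fun i hi => Real.rpow_nonneg (h0 i hi x) _

lemma integral_mul_mul_rpow_le {X : Type*} [TopologicalSpace X] [CompactSpace X]
    [MeasurableSpace X] [OpensMeasurableSpace X] {μ : Measure X} [IsFiniteMeasure μ]
    {f g h : X → ℝ} {u v w : ℝ} (hf : Continuous f) (hg : Continuous g) (hh : Continuous h)
    (hf0 : ∀ x, 0 ≤ f x) (hg0 : ∀ x, 0 ≤ g x) (hh0 : ∀ x, 0 ≤ h x)
    (hu : 0 ≤ u) (hv : 0 ≤ v) (hw : 0 ≤ w) (huvw : u + v + w = 1) :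
    ∫ x, f x ^ u * g x ^ v * h x ^ w ∂μ ≤
      (∫ x, f x ∂μ) ^ u * (∫ x, g x ∂μ) ^ v * (∫ x, h x ∂μ) ^ w := by
  have := integral_prod_rpow_le (μ := μ) (Finset.univ : Finset (Fin 3)) (f := ![f, g, h])
    (w := ![u, v, w]) (by simp [Fin.forall_fin_succ, *]) (by simp [Fin.forall_fin_succ, *])
    (by simp [Fin.forall_fin_succ, *]) (by simp [Fin.sum_univ_three, *])
  simpa [Fin.prod_univ_three] using this

lemma continuous_monoForm {p : ℝ} (hp : 1 < p) :
    Continuous fun z : ℂ × ℂ => monoForm p z.1 z.2 := by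
  have hJ := continuous_dualMap hp
  exact Complex.continuous_re.comp ((continuous_fst.sub continuous_snd).mul
    ((hJ.comp continuous_fst).sub (hJ.comp continuous_snd)))

/-- Hölder's inequality for the pairing of `u` with `dualMap p (g ·)`. -/
lemma norm_integral_mul_dualMap_le {X : Type*} [TopologicalSpace X] [CompactSpace X]
    [MeasurableSpace X] [OpensMeasurableSpace X] {μ : Measure X} [IsFiniteMeasure μ] {p : ℝ} (hp : 1 < p) {u g : X → ℂ} (hu : Continuous u)
    (hg : Continuous g) :
    ‖∫ x, u x * dualMap p (g x) ∂μ‖ ≤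
      (∫ x, ‖u x‖ ^ p ∂μ) ^ (1 / p) * (∫ x, ‖g x‖ ^ p ∂μ) ^ (1 - 1 / p) := by
  have hp0 : 0 < p := by linarith
  have h1 : 1 / p ≤ 1 := by rw [div_le_one hp0]; exact hp.le
  have hc : Continuous fun x => ‖u x‖ ^ p := hu.norm.rpow_const fun _ => Or.inr hp0.le
  have hc' : Continuous fun x => ‖g x‖ ^ p := hg.norm.rpow_const fun _ => Or.inr hp0.le
  have h := integral_mul_mul_rpow_le (μ := μ) (u := 1 / p) (v := 1 - 1 / p) (w := 0)
    hc hc' (continuous_const (y := (1 : ℝ))) (fun x => by positivity) (fun x => by positivity)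
    (fun x => zero_le_one) (by positivity) (by linarith) le_rfl (by ring)
  simp only [Real.rpow_zero, mul_one] at h
  refine (norm_integral_le_integral_norm _).trans (le_trans (le_of_eq ?_) h)
  refine integral_congr_ae (Filter.Eventually.of_forall fun x => ?_)
  simp only [norm_mul, norm_dualMap hp]
  rw [← Real.rpow_mul (norm_nonneg _), ← Real.rpow_mul (norm_nonneg _), mul_one_div_cancel hp0.ne',
    Real.rpow_one, mul_sub, mul_one_div_cancel hp0.ne', mul_one]

section Invariant

variable {G : Type*} [AddCommGroup G] [TopologicalSpace G] [IsTopologicalAddGroup G]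
  [CompactSpace G] [MeasurableSpace G] [BorelSpace G] {μ : Measure G} [IsFiniteMeasure μ]
  [μ.IsAddLeftInvariant]

lemma integral_add_norm_rpow_le {p : ℝ} (hp : 1 < p) {g : G → ℂ} (hg : Continuous g) (h : G) :
    ∫ x, (‖g (x + h)‖ + ‖g x‖) ^ p ∂μ ≤ 2 ^ (p + 1) * ∫ x, ‖g x‖ ^ p ∂μ := by
  have hp0 : 0 < p := by linarith
  have hgh : Continuous fun x => g (x + h) := by fun_prop
  have hc : Continuous fun x => ‖g x‖ ^ p := hg.norm.rpow_const fun _ => Or.inr hp0.le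
  have hc' : Continuous fun x => ‖g (x + h)‖ ^ p := hgh.norm.rpow_const fun _ => Or.inr hp0.le
  have hs : Continuous fun x => (‖g (x + h)‖ + ‖g x‖) ^ p :=
    (hgh.norm.add hg.norm).rpow_const fun _ => Or.inr hp0.le
  calc ∫ x, (‖g (x + h)‖ + ‖g x‖) ^ p ∂μ
      ≤ ∫ x, 2 ^ p * (‖g (x + h)‖ ^ p + ‖g x‖ ^ p) ∂μ := by
        refine integral_mono hs.integrable_of_compactSpace
          ((hc'.add hc).const_mul _).integrable_of_compactSpace fun x => ?_
        have ha := norm_nonneg (g (x + h))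
        have hb := norm_nonneg (g x)
        simp only
        rw [mul_add, ← Real.mul_rpow zero_le_two ha, ← Real.mul_rpow zero_le_two hb]
        rcases le_total ‖g (x + h)‖ ‖g x‖ with hle | hle
        · exact (Real.rpow_le_rpow (by positivity) (by linarith) hp0.le).trans
            (le_add_of_nonneg_left (by positivity))
        · exact (Real.rpow_le_rpow (by positivity) (by linarith) hp0.le).trans
            (le_add_of_nonneg_right (by positivity))
    _ = 2 ^ (p + 1) * ∫ x, ‖g x‖ ^ p ∂μ := by
        rw [integral_const_mul, integral_add hc'.integrable_of_compactSpace
          hc.integrable_of_compactSpace, integral_add_right_eq_self (fun x => ‖g x‖ ^ p),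
          Real.rpow_add_one two_ne_zero]
        ring

lemma le_sqrt_mul_rpow {c S m δ : ℝ} (e : ℝ) (hS : 0 ≤ S) (hm : 0 ≤ m) (hc : 0 ≤ c)
    (h : δ ^ 2 ≤ c * S ^ e * m) : δ ≤ c ^ (1 / 2 : ℝ) * (m ^ (1 / 2 : ℝ) * S ^ (e / 2)) := by
  have h1 := Real.abs_le_sqrt h
  refine (le_abs_self δ).trans (h1.trans (le_of_eq ?_))
  rw [Real.sqrt_eq_rpow, Real.mul_rpow (by positivity) hm, Real.mul_rpow hc (by positivity),
    ← Real.rpow_mul hS]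
  ring_nf

lemma norm_sub_le_monoForm {p : ℝ} (hp : 1 < p) (hp2 : p ≤ 2) (a b : ℂ) :
    ‖a - b‖ ≤ (1 / (p - 1)) ^ (1 / 2 : ℝ) *
      (monoForm p a b ^ (1 / 2 : ℝ) * ((‖a‖ + ‖b‖) ^ p) ^ (1 / p - 1 / 2)) := by
  have hp1 : 0 < p - 1 := by linarith
  have h := le_sqrt_mul_rpow (c := 1 / (p - 1)) (S := ‖a‖ + ‖b‖) (m := monoForm p a b)
    (δ := ‖a - b‖) (2 - p) (by positivity) (monoForm_nonneg hp a b) (by positivity) (by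
      have := norm_sub_sq_le_monoForm hp hp2 a b
      rw [mul_assoc, one_div_mul_eq_div, le_div_iff₀ hp1]
      linarith)
  rwa [← Real.rpow_mul (by positivity), show p * (1 / p - 1 / 2) = (2 - p) / 2 by field_simp]

lemma norm_dualMap_sub_le_monoForm {p : ℝ} (hp2 : 2 ≤ p) (a b : ℂ) :
    ‖dualMap p a - dualMap p b‖ ≤ (p - 1) ^ (1 / 2 : ℝ) *
      (monoForm p a b ^ (1 / 2 : ℝ) * ((‖a‖ + ‖b‖) ^ p) ^ (1 / 2 - 1 / p)) := by
  have h := le_sqrt_mul_rpow (c := p - 1) (S := ‖a‖ + ‖b‖) (m := monoForm p a b)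
    (δ := ‖dualMap p a - dualMap p b‖) (p - 2) (by positivity)
    (monoForm_nonneg (by linarith) a b) (by linarith) (norm_dualMap_sub_sq_le_monoForm hp2 a b)
  rwa [← Real.rpow_mul (by positivity), show p * (1 / 2 - 1 / p) = (p - 2) / 2 by field_simp]

/-- The constant in `norm_integral_sub_mul_dualMap_le`. -/
def pairingConst (p : ℝ) : ℝ :=
  ((1 / (p - 1)) ^ (1 / 2 : ℝ) + (p - 1) ^ (1 / 2 : ℝ)) * (2 ^ (p + 1)) ^ |1 / p - 1 / 2|

lemma pairingConst_nonneg {p : ℝ} (hp : 1 < p) : 0 ≤ pairingConst p := by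
  have hp1 : 0 < p - 1 := by linarith
  unfold pairingConst
  positivity

lemma mul_rpow_mul_rpow_le {c M S B K v w : ℝ} (hc : 0 ≤ c) (hS : 0 ≤ S) (hB : 0 ≤ B)
    (hM : 0 ≤ M) (hK : 0 ≤ K) (hv : 0 ≤ v) (hw : 0 ≤ w) (hvw : v + w = 1 / 2) (h : S ≤ K * B) :
    c * (M ^ (1 / 2 : ℝ) * S ^ v * B ^ w) ≤
      c * K ^ v * M ^ (1 / 2 : ℝ) * B ^ (1 / 2 : ℝ) := by
  calc c * (M ^ (1 / 2 : ℝ) * S ^ v * B ^ w)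
      ≤ c * (M ^ (1 / 2 : ℝ) * (K * B) ^ v * B ^ w) := by gcongr
    _ = c * (M ^ (1 / 2 : ℝ) * K ^ v * (B ^ v * B ^ w)) := by
        rw [Real.mul_rpow hK hB]
        ring
    _ = c * K ^ v * M ^ (1 / 2 : ℝ) * B ^ (1 / 2 : ℝ) := by
        rw [← Real.rpow_add_of_nonneg hB hv hw, hvw]
        ring

/-- Differences of translates of `g`, paired with `dualMap p (g ·)`, are controlled by the
monotonicity form of the duality map. -/
lemma norm_integral_sub_mul_dualMap_le {p : ℝ} (hp : 1 < p) {g : G → ℂ} (hg : Continuous g)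
    (a h : G) :
    ‖∫ x, (g (x + h + a) - g (x + a)) * dualMap p (g x) ∂μ‖ ≤
      pairingConst p * (∫ x, monoForm p (g (x + h)) (g x) ∂μ) ^ (1 / 2 : ℝ) *
        (∫ x, ‖g x‖ ^ p ∂μ) ^ (1 / 2 : ℝ) := by
  have hp0 : 0 < p := by linarith
  have hp1 : 0 < p - 1 := by linarith
  have h1 : 1 / p ≤ 1 := by rw [div_le_one hp0]; exact hp.le
  have hJ := continuous_dualMap hp
  have hgh : Continuous fun x => g (x + h) := by fun_prop
  have hB : Continuous fun x => ‖g x‖ ^ p := hg.norm.rpow_const fun _ => Or.inr hp0.le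
  have hS : Continuous fun x => (‖g (x + h)‖ + ‖g x‖) ^ p :=
    (hgh.norm.add hg.norm).rpow_const fun _ => Or.inr hp0.le
  have hM : Continuous fun x => monoForm p (g (x + h)) (g x) :=
    (continuous_monoForm hp).comp (hgh.prodMk hg)
  have hM0 : ∀ x, 0 ≤ monoForm p (g (x + h)) (g x) := fun x => monoForm_nonneg hp _ _
  have hSB := integral_add_norm_rpow_le (μ := μ) hp hg h
  have tr : ∀ F : G → ℝ, ∫ x, F (x + a) ∂μ = ∫ x, F x ∂μ := fun F =>
    integral_add_right_eq_self F a
  have iM : 0 ≤ ∫ x, monoForm p (g (x + h)) (g x) ∂μ := integral_nonneg hM0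
  have iS : 0 ≤ ∫ x, (‖g (x + h)‖ + ‖g x‖) ^ p ∂μ := integral_nonneg fun x => by positivity
  have iB : 0 ≤ ∫ x, ‖g x‖ ^ p ∂μ := integral_nonneg fun x => by positivity
  set M := ∫ x, monoForm p (g (x + h)) (g x) ∂μ
  set S := ∫ x, (‖g (x + h)‖ + ‖g x‖) ^ p ∂μ
  set B := ∫ x, ‖g x‖ ^ p ∂μ
  rcases le_total p 2 with hp2 | hp2
  · have hv : 0 ≤ 1 / p - 1 / 2 := by
      rw [sub_nonneg]
      exact one_div_le_one_div_of_le hp0 hp2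
    have key := integral_mul_mul_rpow_le (μ := μ) (u := 1 / 2) (v := 1 / p - 1 / 2) (w := 1 - 1 / p)
      (hM.comp (continuous_add_const a)) (hS.comp (continuous_add_const a)) hB (fun x => hM0 _)
      (fun x => by simp only [Function.comp_apply]; positivity) (fun x => by positivity)
      (by norm_num) hv (by linarith) (by ring)
    simp only [Function.comp_def] at key
    rw [tr fun x => monoForm p (g (x + h)) (g x), tr fun x => (‖g (x + h)‖ + ‖g x‖) ^ p] at key
    calc _ ≤ ∫ x, ‖(g (x + h + a) - g (x + a)) * dualMap p (g x)‖ ∂μ :=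
          norm_integral_le_integral_norm _
      _ ≤ ∫ x, (1 / (p - 1)) ^ (1 / 2 : ℝ) * (monoForm p (g (x + a + h)) (g (x + a)) ^ (1 / 2 : ℝ) *
            ((‖g (x + a + h)‖ + ‖g (x + a)‖) ^ p) ^ (1 / p - 1 / 2) *
              (‖g x‖ ^ p) ^ (1 - 1 / p)) ∂μ := by
          refine integral_mono ?_ ?_ fun x => ?_
          · exact Continuous.integrable_of_compactSpace (by fun_prop)
          · refine Continuous.integrable_of_compactSpace (((Continuous.mul ?_ ?_).mul ?_).const_mul _)
            · exact (hM.comp (continuous_add_const a)).rpow_const fun _ => Or.inr (by norm_num)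
            · exact (hS.comp (continuous_add_const a)).rpow_const fun _ => Or.inr hv
            · exact hB.rpow_const fun _ => Or.inr (by linarith)
          · simp only [norm_mul, norm_dualMap hp]
            rw [← Real.rpow_mul (norm_nonneg (g x)), mul_sub, mul_one_div_cancel hp0.ne', mul_one,
              add_right_comm x h a, ← mul_assoc]
            gcongr
            exact norm_sub_le_monoForm hp hp2 _ _
      _ ≤ (1 / (p - 1)) ^ (1 / 2 : ℝ) * (M ^ (1 / 2 : ℝ) * S ^ (1 / p - 1 / 2) * B ^ (1 - 1 / p)) := by
          rw [integral_const_mul]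
          gcongr
      _ ≤ (1 / (p - 1)) ^ (1 / 2 : ℝ) * (2 ^ (p + 1)) ^ (1 / p - 1 / 2) * M ^ (1 / 2 : ℝ) *
            B ^ (1 / 2 : ℝ) :=
          mul_rpow_mul_rpow_le (by positivity) iS iB iM (by positivity) hv (by linarith) (by ring)
            hSB
      _ ≤ _ := by
          unfold pairingConst
          rw [abs_of_nonneg hv]
          gcongr
          exact le_add_of_nonneg_right (by positivity)
  · have hv : 0 ≤ 1 / 2 - 1 / p := by
      rw [sub_nonneg]
      exact one_div_le_one_div_of_le two_pos hp2
    have key := integral_mul_mul_rpow_le (μ := μ) (u := 1 / 2) (v := 1 / 2 - 1 / p) (w := 1 / p)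
      hM hS (hB.comp (continuous_add_const (h + a))) hM0 (fun x => by positivity)
      (fun x => by simp only [Function.comp_apply]; positivity)
      (by norm_num) hv (by positivity) (by ring)
    simp only [Function.comp_def] at key
    rw [integral_add_right_eq_self (fun x => ‖g x‖ ^ p)] at key
    have shift : ∫ x, (g (x + h + a) - g (x + a)) * dualMap p (g x) ∂μ =
        -∫ x, g (x + h + a) * (dualMap p (g (x + h)) - dualMap p (g x)) ∂μ := by
      have e1 : ∫ x, g (x + h + a) * dualMap p (g (x + h)) ∂μ =
          ∫ x, g (x + a) * dualMap p (g x) ∂μ :=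
        integral_add_right_eq_self (fun x => g (x + a) * dualMap p (g x)) h
      simp only [sub_mul, mul_sub]
      rw [integral_sub, integral_sub, e1]
      · ring
      all_goals exact Continuous.integrable_of_compactSpace (by fun_prop)
    calc _ ≤ ∫ x, ‖g (x + h + a) * (dualMap p (g (x + h)) - dualMap p (g x))‖ ∂μ := by
          rw [shift, norm_neg]
          exact norm_integral_le_integral_norm _
      _ ≤ ∫ x, (p - 1) ^ (1 / 2 : ℝ) * (monoForm p (g (x + h)) (g x) ^ (1 / 2 : ℝ) *
            ((‖g (x + h)‖ + ‖g x‖) ^ p) ^ (1 / 2 - 1 / p) *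
              (‖g (x + (h + a))‖ ^ p) ^ (1 / p)) ∂μ := by
          refine integral_mono ?_ ?_ fun x => ?_
          · exact Continuous.integrable_of_compactSpace (by fun_prop)
          · refine Continuous.integrable_of_compactSpace (((Continuous.mul ?_ ?_).mul ?_).const_mul _)
            · exact hM.rpow_const fun _ => Or.inr (by norm_num)
            · exact hS.rpow_const fun _ => Or.inr hv
            · exact (hB.comp (continuous_add_const (h + a))).rpow_const fun _ =>
                Or.inr (by positivity)
          · simp only [norm_mul]
            rw [← Real.rpow_mul (norm_nonneg (g (x + (h + a)))), mul_one_div_cancel hp0.ne',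
              Real.rpow_one, ← add_assoc x h a, ← mul_assoc, mul_comm ‖g (x + h + a)‖]
            gcongr
            exact norm_dualMap_sub_le_monoForm hp2 _ _
      _ ≤ (p - 1) ^ (1 / 2 : ℝ) * (M ^ (1 / 2 : ℝ) * S ^ (1 / 2 - 1 / p) * B ^ (1 / p)) := by
          rw [integral_const_mul]
          gcongr
      _ ≤ (p - 1) ^ (1 / 2 : ℝ) * (2 ^ (p + 1)) ^ (1 / 2 - 1 / p) * M ^ (1 / 2 : ℝ) *
            B ^ (1 / 2 : ℝ) :=
          mul_rpow_mul_rpow_le (by positivity) iS iB iM (by positivity) hv (by positivity) (by ring)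
            hSB
      _ ≤ _ := by
          unfold pairingConst
          rw [abs_sub_comm, abs_of_nonneg hv]
          gcongr
          exact le_add_of_nonneg_left (by positivity)

/-- The monotonicity form at a translate is a second difference paired with the duality map. -/
lemma integral_monoForm_eq {p : ℝ} (hp : 1 < p) {g : G → ℂ} (hg : Continuous g) (h : G) :
    ∫ x, monoForm p (g (x + h)) (g x) ∂μ =
      (∫ x, (2 * g x - g (x + h) - g (x + -h)) * dualMap p (g x) ∂μ).re := by
  have hJ := continuous_dualMap hp
  have e1 : ∫ x, g (x + h) * dualMap p (g (x + h)) ∂μ = ∫ x, g x * dualMap p (g x) ∂μ :=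
    integral_add_right_eq_self (fun x => g x * dualMap p (g x)) h
  have e2 : ∫ x, g x * dualMap p (g (x + h)) ∂μ = ∫ x, g (x + -h) * dualMap p (g x) ∂μ := by
    rw [← integral_add_right_eq_self (fun x => g (x + -h) * dualMap p (g x)) h]
    simp only [add_assoc, add_neg_cancel, add_zero]
  unfold monoForm
  have hre := integral_re (𝕜 := ℂ) (μ := μ)
    (f := fun x => (g (x + h) - g x) * (dualMap p (g (x + h)) - dualMap p (g x)))
    (Continuous.integrable_of_compactSpace (by fun_prop))
  simp only [RCLike.re_eq_complex_re] at hre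
  rw [hre]
  congr 1
  simp only [sub_mul, mul_sub, mul_assoc]
  rw [integral_sub, integral_sub, integral_sub, integral_sub, integral_sub, e1, e2,
    integral_const_mul]
  · ring
  all_goals exact Continuous.integrable_of_compactSpace (by fun_prop)

end Invariant

variable {d : ℕ}

lemma mFourier_apply_add (k : Fin d → ℤ) (x y : UnitAddTorus (Fin d)) :
    mFourier k (x + y) = mFourier k x * mFourier k y := by
  simp only [mFourier, ContinuousMap.coe_mk, ← Finset.prod_mul_distrib, Pi.add_apply]
  refine Finset.prod_congr rfl fun i _ => ?_
  rw [fourier_apply, fourier_apply, fourier_apply, smul_add, AddCircle.toCircle_add, Circle.coe_mul]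

/-- The quotient map `ℝᵈ → 𝕋ᵈ`. -/
def torusMk (y : EuclideanSpace ℝ (Fin d)) : UnitAddTorus (Fin d) := fun i => (y i : UnitAddCircle)

lemma torusMk_neg (y : EuclideanSpace ℝ (Fin d)) : torusMk (-y) = -torusMk y := by
  ext i
  simp [torusMk]

lemma mFourier_torusMk (k : Fin d → ℤ) (y : EuclideanSpace ℝ (Fin d)) :
    mFourier k (torusMk y) = Real.fourierChar (inner ℝ y (freq k)) := by
  rw [Real.fourierChar_apply]
  simp only [mFourier, ContinuousMap.coe_mk, torusMk, fourier_coe_apply, ← Complex.exp_sum]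
  congr 1
  simp [PiLp.inner_apply, freq, Finset.mul_sum, Finset.sum_mul]
  refine Finset.sum_congr rfl fun i _ => ?_
  ring

/-- The trigonometric polynomial with spectrum in `S` and coefficients `c`. -/
def trigPoly (S : Finset (Fin d → ℤ)) (c : (Fin d → ℤ) → ℂ) (x : UnitAddTorus (Fin d)) : ℂ :=
  ∑ k ∈ S, c k * mFourier k x

lemma continuous_trigPoly (S : Finset (Fin d → ℤ)) (c : (Fin d → ℤ) → ℂ) :
    Continuous (trigPoly S c) := by
  unfold trigPoly
  fun_prop

/-- The summands in the frequency expansion of the pairing of `trigPoly S c` with its image under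
the duality map. -/
def pairCoeff (p : ℝ) (S : Finset (Fin d → ℤ)) (c : (Fin d → ℤ) → ℂ) (k : Fin d → ℤ) : ℂ :=
  c k * ∫ x, mFourier k x * dualMap p (trigPoly S c x) ∂(torusMeasure d)

/-- The `p`-th power of the `L^p` norm of `trigPoly S c`. -/
def normPow (p : ℝ) (S : Finset (Fin d → ℤ)) (c : (Fin d → ℤ) → ℂ) : ℝ :=
  ∫ x, ‖trigPoly S c x‖ ^ p ∂(torusMeasure d)

lemma normPow_nonneg (p : ℝ) (S : Finset (Fin d → ℤ)) (c : (Fin d → ℤ) → ℂ) :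
    0 ≤ normPow p S c := integral_nonneg fun x => by positivity

lemma integral_trigPoly_mul_dualMap {p : ℝ} (hp : 1 < p) (S : Finset (Fin d → ℤ))
    (b c : (Fin d → ℤ) → ℂ) :
    ∫ x, trigPoly S (fun k => b k * c k) x * dualMap p (trigPoly S c x) ∂(torusMeasure d) =
      ∑ k ∈ S, b k * pairCoeff p S c k := by
  have hJ := (continuous_dualMap hp).comp (continuous_trigPoly S c)
  simp only [Function.comp_def] at hJ
  conv_lhs => simp only [trigPoly, Finset.sum_mul]
  rw [integral_finsetSum]
  · refine Finset.sum_congr rfl fun k _ => ?_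
    rw [pairCoeff, ← mul_assoc, ← integral_const_mul]
    simp only [mul_assoc, trigPoly]
  · intro k _
    exact Continuous.integrable_of_compactSpace
      (((mFourier k).continuous.const_mul _).mul hJ)

lemma sum_pairCoeff {p : ℝ} (hp : 1 < p) (S : Finset (Fin d → ℤ)) (c : (Fin d → ℤ) → ℂ) :
    ∑ k ∈ S, pairCoeff p S c k = (normPow p S c : ℂ) := by
  have h := integral_trigPoly_mul_dualMap hp S (fun _ => 1) c
  simp only [one_mul, mul_dualMap hp] at h
  rw [← h]
  exact integral_ofReal

lemma trigPoly_add (S : Finset (Fin d → ℤ)) (c : (Fin d → ℤ) → ℂ) (x a : UnitAddTorus (Fin d)) :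
    trigPoly S c (x + a) = trigPoly S (fun k => mFourier k a * c k) x := by
  unfold trigPoly
  refine Finset.sum_congr rfl fun k _ => ?_
  rw [mFourier_apply_add]
  ring

lemma integral_monoForm_trigPoly {p : ℝ} (hp : 1 < p) (S : Finset (Fin d → ℤ))
    (c : (Fin d → ℤ) → ℂ) (h : UnitAddTorus (Fin d)) :
    ∫ x, monoForm p (trigPoly S c (x + h)) (trigPoly S c x) ∂(torusMeasure d) =
      (∑ k ∈ S, (mFourier k h - 1) * (mFourier k (-h) - 1) * pairCoeff p S c k).re := by
  rw [integral_monoForm_eq hp (continuous_trigPoly S c), ← integral_trigPoly_mul_dualMap hp]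
  congr 1
  refine integral_congr_ae (Eventually.of_forall fun x => ?_)
  simp only [trigPoly_add]
  congr 1
  simp only [trigPoly, Finset.mul_sum, ← Finset.sum_sub_distrib]
  refine Finset.sum_congr rfl fun k _ => ?_
  have : mFourier k h * mFourier k (-h) = 1 := by
    rw [← mFourier_apply_add, add_neg_cancel]
    simp [mFourier]
  linear_combination (-c k * mFourier k x) * this

lemma norm_sum_sub_mul_pairCoeff_le {p : ℝ} (hp : 1 < p) (S : Finset (Fin d → ℤ))
    (c : (Fin d → ℤ) → ℂ) (a h : UnitAddTorus (Fin d)) :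
    ‖∑ k ∈ S, (mFourier k h - 1) * mFourier k a * pairCoeff p S c k‖ ≤
      pairingConst p *
        (∑ k ∈ S, (mFourier k h - 1) * (mFourier k (-h) - 1) * pairCoeff p S c k).re ^ (1 / 2 : ℝ) *
        normPow p S c ^ (1 / 2 : ℝ) := by
  have key := norm_integral_sub_mul_dualMap_le (μ := torusMeasure d) hp (continuous_trigPoly S c) a h
  rw [integral_monoForm_trigPoly hp] at key
  refine le_of_eq_of_le ?_ key
  rw [← integral_trigPoly_mul_dualMap hp]
  congr 1
  refine integral_congr_ae (Eventually.of_forall fun x => ?_)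
  simp only [trigPoly_add]
  congr 1
  simp only [trigPoly, ← Finset.sum_sub_distrib]
  refine Finset.sum_congr rfl fun k _ => ?_
  ring

/-- The Dirichlet form of the `j`-th partial derivative. -/
def dirichletCoord (p : ℝ) (S : Finset (Fin d → ℤ)) (c : (Fin d → ℤ) → ℂ) (j : Fin d) : ℝ :=
  (∑ k ∈ S, ((k j : ℂ) ^ 2) * pairCoeff p S c k).re

lemma tendsto_fourierChar_sub_one_div (r : ℝ) :
    Tendsto (fun t : ℝ => ((Real.fourierChar (t / (2 * Real.pi) * r) : ℂ) - 1) / t) (𝓝[>] 0)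
      (𝓝 (Complex.I * r)) := by
  have h : HasDerivAt (fun t : ℝ => Complex.exp (Complex.I * r * (t : ℂ))) (Complex.I * r) 0 := by
    have := ((hasDerivAt_id (0 : ℝ)).ofReal_comp.const_mul (Complex.I * r)).cexp
    simpa using this
  have h2 := (hasDerivAt_iff_tendsto_slope_zero.1 h).mono_left
    (nhdsWithin_mono (0 : ℝ) fun t ht => ne_of_gt ht)
  refine h2.congr fun t => ?_
  rw [Real.fourierChar_apply]
  simp only [zero_add, Complex.ofReal_zero, mul_zero, Complex.exp_zero, Complex.real_smul,
    Complex.ofReal_inv]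
  rw [div_eq_inv_mul]
  congr 3
  push_cast
  field_simp

lemma mFourier_torusMk_single (k : Fin d → ℤ) (j : Fin d) (t : ℝ) :
    mFourier k (torusMk (EuclideanSpace.single j t)) = Real.fourierChar (t * k j) := by
  rw [mFourier_torusMk]
  simp [EuclideanSpace.inner_single_left, freq]

/-- Bernstein-type bound for the pairing of a partial derivative with the duality map. -/
lemma norm_sum_mul_pairCoeff_le {p : ℝ} (hp : 1 < p) (S : Finset (Fin d → ℤ))
    (c : (Fin d → ℤ) → ℂ) (a : UnitAddTorus (Fin d)) (j : Fin d) :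
    0 ≤ dirichletCoord p S c j ∧
    ‖∑ k ∈ S, (Complex.I * k j) * mFourier k a * pairCoeff p S c k‖ ≤
      pairingConst p * dirichletCoord p S c j ^ (1 / 2 : ℝ) * normPow p S c ^ (1 / 2 : ℝ) := by
  set H : ℝ → UnitAddTorus (Fin d) := fun t => torusMk (EuclideanSpace.single j (t / (2 * Real.pi)))
  have hH : ∀ k : Fin d → ℤ, Tendsto (fun t : ℝ => (mFourier k (H t) - 1) / t) (𝓝[>] 0)
      (𝓝 (Complex.I * k j)) := fun k => by
    simpa only [H, mFourier_torusMk_single, Complex.ofReal_intCast] using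
      tendsto_fourierChar_sub_one_div (k j : ℝ)
  have hH' : ∀ k : Fin d → ℤ, Tendsto (fun t : ℝ => (mFourier k (-H t) - 1) / t) (𝓝[>] 0)
      (𝓝 (Complex.I * (-k j))) := fun k => by
    have h := tendsto_fourierChar_sub_one_div (-k j : ℝ)
    simp only [mul_neg, ← neg_mul, Complex.ofReal_neg, Complex.ofReal_intCast] at h ⊢
    have e : ∀ t, -H t = torusMk (EuclideanSpace.single j (-(t / (2 * Real.pi)))) := fun t => by
      rw [← torusMk_neg]
      congr 1
      ext i
      by_cases hi : i = j <;> simp [hi]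
    simpa only [e, mFourier_torusMk_single] using h
  have t1 : Tendsto (fun t : ℝ => (∑ k ∈ S, ((mFourier k (H t) - 1) / t) *
      ((mFourier k (-H t) - 1) / t) * pairCoeff p S c k).re) (𝓝[>] 0)
      (𝓝 (dirichletCoord p S c j)) := by
    refine (Complex.continuous_re.tendsto _).comp (tendsto_finsetSum _ fun k _ => ?_)
    have := ((hH k).mul (hH' k)).mul_const (pairCoeff p S c k)
    convert this using 3
    linear_combination ((k j : ℂ) ^ 2) * Complex.I_mul_I
  have t2 : Tendsto (fun t : ℝ => ‖∑ k ∈ S, ((mFourier k (H t) - 1) / t) *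
      mFourier k a * pairCoeff p S c k‖) (𝓝[>] 0)
      (𝓝 ‖∑ k ∈ S, (Complex.I * k j) * mFourier k a * pairCoeff p S c k‖) :=
    (tendsto_finsetSum _ fun k _ => ((hH k).mul_const _).mul_const _).norm
  have e1 : ∀ t : ℝ, (∑ k ∈ S, ((mFourier k (H t) - 1) / t) *
      ((mFourier k (-H t) - 1) / t) * pairCoeff p S c k).re =
      (∑ k ∈ S, (mFourier k (H t) - 1) * (mFourier k (-H t) - 1) * pairCoeff p S c k).re *
        (1 / t) ^ 2 := fun t => by
    rw [← Complex.re_mul_ofReal, Finset.sum_mul]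
    congr 1
    refine Finset.sum_congr rfl fun k _ => ?_
    push_cast
    ring
  have hpos : ∀ t : ℝ, 0 ≤
      (∑ k ∈ S, (mFourier k (H t) - 1) * (mFourier k (-H t) - 1) * pairCoeff p S c k).re :=
    fun t => by
      rw [← integral_monoForm_trigPoly hp]
      exact integral_nonneg fun x => monoForm_nonneg hp _ _
  refine ⟨ge_of_tendsto' t1 fun t => ?_, ?_⟩
  · rw [e1]
    exact mul_nonneg (hpos t) (by positivity)
  · refine le_of_tendsto_of_tendsto t2
      (((t1.rpow_const (Or.inr (by norm_num))).const_mul _).mul_const _) ?_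
    filter_upwards [self_mem_nhdsWithin] with t ht
    have ht : 0 < t := ht
    rw [e1, Real.mul_rpow (hpos t) (by positivity), ← Real.sqrt_eq_rpow ((1 / t) ^ 2),
      Real.sqrt_sq (by positivity)]
    have key := norm_sum_sub_mul_pairCoeff_le hp S c a (H t)
    have e2 : ∑ k ∈ S, ((mFourier k (H t) - 1) / t) * mFourier k a * pairCoeff p S c k =
        (∑ k ∈ S, (mFourier k (H t) - 1) * mFourier k a * pairCoeff p S c k) * ((1 / t : ℝ) : ℂ) := by
      rw [Finset.sum_mul]
      refine Finset.sum_congr rfl fun k _ => ?_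
      push_cast
      ring
    rw [e2, norm_mul, Complex.norm_real, Real.norm_of_nonneg (by positivity)]
    refine (mul_le_mul_of_nonneg_right key (by positivity : 0 ≤ 1 / t)).trans (le_of_eq ?_)
    ring

lemma exists_contDiff_eq_inv :
    ∃ q : ℝ → ℝ, ContDiff ℝ ∞ q ∧ (∀ u, 1 ≤ u → u ≤ 9 → q u = u⁻¹) ∧ ∀ u, 10 ≤ u → q u = 0 := by
  let B : ContDiffBump (5 : ℝ) := ⟨4, 9 / 2, by norm_num, by norm_num⟩
  refine ⟨fun u => B u * u⁻¹, ?_, fun u h1 h9 => ?_, fun u h => ?_⟩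
  · rw [contDiff_iff_contDiffAt]
    intro u
    rcases eq_or_ne u 0 with rfl | hu
    · refine (contDiffAt_const (c := (0 : ℝ))).congr_of_eventuallyEq ?_
      filter_upwards [Metric.ball_mem_nhds (0 : ℝ) (by norm_num : (0 : ℝ) < 1 / 2)] with v hv
      rw [Metric.mem_ball, Real.dist_eq, sub_zero, abs_lt] at hv
      rw [B.zero_of_le_dist, zero_mul]
      rw [Real.dist_eq, abs_sub_comm]
      exact (by linarith : (9 / 2 : ℝ) ≤ 5 - v).trans (le_abs_self _)
    · exact B.contDiff.contDiffAt.mul (contDiffAt_inv ℝ hu)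
  · simp only
    rw [B.one_of_mem_closedBall, one_mul]
    rw [Metric.mem_closedBall, Real.dist_eq, abs_le]
    exact ⟨by linarith, by linarith⟩
  · simp only
    rw [B.zero_of_le_dist, zero_mul]
    rw [Real.dist_eq]
    exact (by linarith : (9 / 2 : ℝ) ≤ u - 5).trans (le_abs_self _)

/-- On the annulus `1 ≤ |ξ| ≤ 3` the symbol `ξⱼ / |ξ|²` is the Fourier transform of an integrable
function. -/
lemma exists_integrable_fourier_eq (j : Fin d) :
    ∃ f : EuclideanSpace ℝ (Fin d) → ℂ, Integrable f ∧
      ∀ ξ : EuclideanSpace ℝ (Fin d), 1 ≤ ‖ξ‖ → ‖ξ‖ ≤ 3 →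
        ∫ y, (Real.fourierChar (inner ℝ y ξ) : ℂ) * f y = ((ξ j / ‖ξ‖ ^ 2 : ℝ) : ℂ) := by
  obtain ⟨q, hq, hq1, hq0⟩ := exists_contDiff_eq_inv
  let m : EuclideanSpace ℝ (Fin d) → ℂ := fun ξ => ((ξ j * q (‖ξ‖ ^ 2) : ℝ) : ℂ)
  have hm : ContDiff ℝ ∞ m := by
    refine Complex.ofRealCLM.contDiff.comp (ContDiff.mul ?_ (hq.comp (contDiff_norm_sq ℝ)))
    fun_prop
  have hc : HasCompactSupport m := by
    refine HasCompactSupport.intro (isCompact_closedBall 0 4) fun ξ hξ => ?_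
    rw [Metric.mem_closedBall, dist_zero_right, not_le] at hξ
    simp only [m]
    rw [hq0 _ (by nlinarith), mul_zero, Complex.ofReal_zero]
  let M : 𝓢(EuclideanSpace ℝ (Fin d), ℂ) := hc.toSchwartzMap hm
  let F : 𝓢(EuclideanSpace ℝ (Fin d), ℂ) := 𝓕 M
  refine ⟨F, F.integrable, fun ξ h1 h3 => ?_⟩
  have h : (𝓕⁻ F) ξ = M ξ := by rw [FourierTransform.fourierInv_fourier_eq]
  rw [SchwartzMap.fourierInv_coe, Real.fourierInv_eq] at h
  simp only [Circle.smul_def, smul_eq_mul] at h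
  rw [h]
  simp only [M, HasCompactSupport.toSchwartzMap_toFun, m]
  rw [hq1 _ (by nlinarith) (by nlinarith), div_eq_mul_inv]

/-- The frequencies of `S` lie in the annulus `N ≤ |k| ≤ 3N`. -/
def InAnnulus (N : ℕ) (S : Finset (Fin d → ℤ)) : Prop :=
  ∀ k ∈ S, (N : ℝ) ≤ ‖freq k‖ ∧ ‖freq k‖ ≤ 3 * N

/-- The pairing of `Λ^s g` with the image of `g = trigPoly S c` under the duality map. -/
def energy (p s : ℝ) (S : Finset (Fin d → ℤ)) (c : (Fin d → ℤ) → ℂ) : ℝ :=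
  (∑ k ∈ S, ((‖freq k‖ ^ s : ℝ) : ℂ) * pairCoeff p S c k).re

lemma norm_freq_sq (k : Fin d → ℤ) : ‖freq k‖ ^ 2 = ∑ j, (k j : ℝ) ^ 2 := by
  simp [EuclideanSpace.norm_sq_eq, freq]

lemma energy_two (p : ℝ) (S : Finset (Fin d → ℤ)) (c : (Fin d → ℤ) → ℂ) :
    energy p 2 S c = ∑ j, dirichletCoord p S c j := by
  unfold energy dirichletCoord
  rw [← Complex.re_sum, Finset.sum_comm]
  congr 1
  refine Finset.sum_congr rfl fun k _ => ?_
  rw [Real.rpow_two, norm_freq_sq, ← Finset.sum_mul]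
  push_cast
  rfl

lemma normPow_eq_sum_integral {p : ℝ} (hp : 1 < p) {N : ℕ} (hN : 0 < N)
    {f : Fin d → EuclideanSpace ℝ (Fin d) → ℂ} (hf : ∀ j, Integrable (f j))
    (hfξ : ∀ j, ∀ ξ : EuclideanSpace ℝ (Fin d), 1 ≤ ‖ξ‖ → ‖ξ‖ ≤ 3 →
        ∫ y, (Real.fourierChar (inner ℝ y ξ) : ℂ) * f j y = ((ξ j / ‖ξ‖ ^ 2 : ℝ) : ℂ))
    {S : Finset (Fin d → ℤ)} (hS : InAnnulus N S) (c : (Fin d → ℤ) → ℂ) :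
    (normPow p S c : ℂ) = ∑ j, ∫ y, f j y * ((-Complex.I / N) * ∑ k ∈ S,
      (Complex.I * k j) * mFourier k (torusMk ((N : ℝ)⁻¹ • y)) * pairCoeff p S c k) := by
  have hN' : (0 : ℝ) < N := by exact_mod_cast hN
  have hint : ∀ j (ξ : EuclideanSpace ℝ (Fin d)),
      Integrable fun y => (Real.fourierChar (inner ℝ y ξ) : ℂ) * f j y := fun j ξ => by
    refine (hf j).bdd_mul (c := 1) ?_ (Eventually.of_forall fun y => (Circle.norm_coe _).le)
    refine Continuous.aestronglyMeasurable ?_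
    exact continuous_subtype_val.comp (Real.continuous_fourierChar.comp (by fun_prop))
  have e1 : ∀ j, ∫ y, f j y * ((-Complex.I / N) * ∑ k ∈ S,
      (Complex.I * k j) * mFourier k (torusMk ((N : ℝ)⁻¹ • y)) * pairCoeff p S c k) =
      ∑ k ∈ S, ((k j / N : ℂ) * pairCoeff p S c k) *
        ((((N : ℝ)⁻¹ • freq k) j / ‖(N : ℝ)⁻¹ • freq k‖ ^ 2 : ℝ) : ℂ) := fun j => by
    have e2 : ∀ y, f j y * ((-Complex.I / N) * ∑ k ∈ S,
        (Complex.I * k j) * mFourier k (torusMk ((N : ℝ)⁻¹ • y)) * pairCoeff p S c k) =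
        ∑ k ∈ S, ((k j / N : ℂ) * pairCoeff p S c k) *
          ((Real.fourierChar (inner ℝ y ((N : ℝ)⁻¹ • freq k)) : ℂ) * f j y) := fun y => by
      rw [Finset.mul_sum, Finset.mul_sum]
      refine Finset.sum_congr rfl fun k _ => ?_
      rw [mFourier_torusMk, real_inner_smul_left, real_inner_smul_right]
      linear_combination (-(f j y) / N * k j *
        (Real.fourierChar ((N : ℝ)⁻¹ * inner ℝ y (freq k)) : ℂ) * pairCoeff p S c k) *
          Complex.I_mul_I
    simp_rw [e2]
    rw [integral_finsetSum]
    · refine Finset.sum_congr rfl fun k hk => ?_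
      have hn : ‖(N : ℝ)⁻¹ • freq k‖ = ‖freq k‖ / N := by
        rw [norm_smul, norm_inv, Real.norm_of_nonneg hN'.le, inv_mul_eq_div]
      rw [integral_const_mul, hfξ]
      · rw [hn, le_div_iff₀ hN', one_mul]
        exact (hS k hk).1
      · rw [hn, div_le_iff₀ hN']
        exact (hS k hk).2
    · exact fun k _ => (hint j _).const_mul _
  simp_rw [e1]
  rw [Finset.sum_comm, ← sum_pairCoeff hp]
  refine Finset.sum_congr rfl fun k hk => ?_
  have hk0 : ‖freq k‖ ^ 2 ≠ 0 := (pow_pos (hN'.trans_le (hS k hk).1) 2).ne'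
  have e3 : ∑ j, (k j / N : ℝ) * (((N : ℝ)⁻¹ • freq k) j / ‖(N : ℝ)⁻¹ • freq k‖ ^ 2) = 1 := by
    have : ∀ j, (k j / N : ℝ) * (((N : ℝ)⁻¹ • freq k) j / ‖(N : ℝ)⁻¹ • freq k‖ ^ 2) =
        (k j : ℝ) ^ 2 / ‖freq k‖ ^ 2 := fun j => by
      rw [norm_smul, norm_inv, Real.norm_of_nonneg hN'.le]
      simp only [PiLp.smul_apply, smul_eq_mul, freq]
      field_simp
    simp_rw [this]
    rw [← Finset.sum_div, ← norm_freq_sq, div_self hk0]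
  have e4 := congrArg (fun r : ℝ => (r : ℂ) * pairCoeff p S c k) e3
  simp only [Complex.ofReal_sum, Complex.ofReal_one, one_mul, Finset.sum_mul] at e4
  refine e4.symm.trans ?_
  refine Finset.sum_congr rfl fun j _ => ?_
  push_cast
  ring

/-- The lower bound for the Laplacian of frequency-localized functions. -/
lemma exists_mul_normPow_le_energy_two {p : ℝ} (hp : 1 < p) (d : ℕ) :
    ∃ c₀ : ℝ, 0 < c₀ ∧ ∀ N : ℕ, 0 < N → ∀ S : Finset (Fin d → ℤ), InAnnulus N S →
      ∀ c : (Fin d → ℤ) → ℂ, c₀ * (N : ℝ) ^ 2 * normPow p S c ≤ energy p 2 S c := by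
  choose f hf hfξ using fun j : Fin d => exists_integrable_fourier_eq j
  set L := ∑ j, ∫ y, ‖f j y‖
  have hL : 0 ≤ L := Finset.sum_nonneg fun j _ => integral_nonneg fun y => norm_nonneg _
  have hC := pairingConst_nonneg hp
  refine ⟨1 / ((L * pairingConst p) ^ 2 + 1), by positivity, fun N hN S hS c => ?_⟩
  have hN' : (0 : ℝ) < N := by exact_mod_cast hN
  have hE0 : ∀ j, 0 ≤ dirichletCoord p S c j := fun j => (norm_sum_mul_pairCoeff_le hp S c 0 j).1
  have hE : 0 ≤ energy p 2 S c := by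
    rw [energy_two]
    exact Finset.sum_nonneg fun j _ => hE0 j
  have hB := normPow_nonneg p S c
  have hle : normPow p S c ≤
      L * (pairingConst p * energy p 2 S c ^ (1 / 2 : ℝ) * normPow p S c ^ (1 / 2 : ℝ) / N) := by
    calc normPow p S c = ‖(normPow p S c : ℂ)‖ := by
          rw [Complex.norm_real, Real.norm_of_nonneg hB]
      _ ≤ ∑ j, (∫ y, ‖f j y‖) *
          (pairingConst p * energy p 2 S c ^ (1 / 2 : ℝ) * normPow p S c ^ (1 / 2 : ℝ) / N) := by
          rw [normPow_eq_sum_integral hp hN hf hfξ hS c]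
          refine norm_sum_le_of_le _ fun j _ => ?_
          rw [← integral_mul_const]
          refine norm_integral_le_of_norm_le ((hf j).norm.mul_const _)
            (Eventually.of_forall fun y => ?_)
          rw [norm_mul, norm_mul, norm_div, norm_neg, Complex.norm_I, Complex.norm_natCast,
            one_div_mul_eq_div]
          gcongr
          refine (norm_sum_mul_pairCoeff_le hp S c _ j).2.trans ?_
          gcongr
          · exact hE0 j
          · rw [energy_two]
            exact Finset.single_le_sum (fun i _ => hE0 i) (Finset.mem_univ j)
      _ = _ := by rw [← Finset.sum_mul]
  rw [← Real.sqrt_eq_rpow, ← Real.sqrt_eq_rpow] at hle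
  set B := normPow p S c
  set E := energy p 2 S c
  rcases hB.eq_or_lt with h0 | h0
  · rw [← h0, mul_zero]
    exact hE
  have h1 : N * √B ≤ L * pairingConst p * √E := by
    have hs : 0 < √B := Real.sqrt_pos.2 h0
    refine le_of_mul_le_mul_right ?_ hs
    rw [mul_assoc, Real.mul_self_sqrt hB]
    calc N * B ≤ N * (L * (pairingConst p * √E * √B / N)) := by gcongr
      _ = _ := by field_simp
  have h2 : (N : ℝ) ^ 2 * B ≤ (L * pairingConst p) ^ 2 * E := by
    calc (N : ℝ) ^ 2 * B = (N * √B) ^ 2 := by rw [mul_pow, Real.sq_sqrt hB]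
      _ ≤ (L * pairingConst p * √E) ^ 2 := by gcongr
      _ = _ := by rw [mul_pow _ √E, Real.sq_sqrt hE]
  rw [mul_assoc, one_div_mul_eq_div, div_le_iff₀ (by positivity)]
  linarith

lemma energy_eq_sum (p s : ℝ) (S : Finset (Fin d → ℤ)) (c : (Fin d → ℤ) → ℂ) :
    energy p s S c = ∑ k ∈ S, ‖freq k‖ ^ s * (pairCoeff p S c k).re := by
  simp [energy, Complex.re_sum]

lemma normPow_eq_sum {p : ℝ} (hp : 1 < p) (S : Finset (Fin d → ℤ)) (c : (Fin d → ℤ) → ℂ) :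
    normPow p S c = ∑ k ∈ S, (pairCoeff p S c k).re := by
  rw [← Complex.re_sum, sum_pairCoeff hp, Complex.ofReal_re]

/-- A lower bound `μ` for the energy passes to the resolvent differences `t⁻¹ - (t + Λ²)⁻¹`. -/
lemma resolvent_le {p μ : ℝ} (hp : 1 < p) (hμ : 0 < μ) {S : Finset (Fin d → ℤ)}
    (h : ∀ c : (Fin d → ℤ) → ℂ, μ * normPow p S c ≤ energy p 2 S c)
    (c : (Fin d → ℤ) → ℂ) {t : ℝ} (ht : 0 < t) :
    (t⁻¹ - (t + μ)⁻¹) * normPow p S c ≤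
      ∑ k ∈ S, (t⁻¹ - (t + ‖freq k‖ ^ 2)⁻¹) * (pairCoeff p S c k).re := by
  have hp0 : 0 < p := by linarith
  set r : (Fin d → ℤ) → ℂ := fun k => (((t + ‖freq k‖ ^ 2)⁻¹ : ℝ) : ℂ)
  set b : (Fin d → ℤ) → ℂ := fun k => r k * c k
  have hU := normPow_nonneg p S b
  have hB := normPow_nonneg p S c
  have hc : c = fun k => (((t + ‖freq k‖ ^ 2) : ℝ) : ℂ) * b k := by
    ext k
    have : t + ‖freq k‖ ^ 2 ≠ 0 := by positivity
    simp only [b, r]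
    rw [← mul_assoc, ← Complex.ofReal_mul, mul_inv_cancel₀ this, Complex.ofReal_one, one_mul]
  have h1 : (t + μ) * normPow p S b ≤
      normPow p S c ^ (1 / p) * normPow p S b ^ (1 - 1 / p) := by
    have e : ∫ x, trigPoly S c x * dualMap p (trigPoly S b x) ∂(torusMeasure d) =
        ∑ k ∈ S, (((t + ‖freq k‖ ^ 2) : ℝ) : ℂ) * pairCoeff p S b k := by
      rw [← integral_trigPoly_mul_dualMap hp, ← hc]
    have hh := norm_integral_mul_dualMap_le (μ := torusMeasure d) hp (continuous_trigPoly S c)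
      (continuous_trigPoly S b)
    rw [e] at hh
    refine le_trans ?_ ((Complex.re_le_norm _).trans hh)
    have h2 := h b
    rw [energy_eq_sum] at h2
    simp only [Complex.re_sum, Complex.re_ofReal_mul, add_mul, Finset.sum_add_distrib]
    rw [← Finset.mul_sum, ← normPow_eq_sum hp]
    simp only [Real.rpow_two] at h2
    linarith
  have h3 : (t + μ) * normPow p S b ^ (1 / p) ≤ normPow p S c ^ (1 / p) := by
    rcases hU.eq_or_lt with h0 | h0
    · rw [← h0, Real.zero_rpow (by positivity), mul_zero]
      positivity
    · refine le_of_mul_le_mul_right ?_ (Real.rpow_pos_of_pos h0 (1 - 1 / p))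
      rwa [mul_assoc, ← Real.rpow_add h0, add_sub_cancel, Real.rpow_one]
  have h4 : ∑ k ∈ S, (t + ‖freq k‖ ^ 2)⁻¹ * (pairCoeff p S c k).re ≤
      normPow p S b ^ (1 / p) * normPow p S c ^ (1 - 1 / p) := by
    have e := integral_trigPoly_mul_dualMap hp S r c
    have hh := norm_integral_mul_dualMap_le (μ := torusMeasure d) hp (continuous_trigPoly S b)
      (continuous_trigPoly S c)
    rw [e] at hh
    refine le_trans (le_of_eq ?_) ((Complex.re_le_norm _).trans hh)
    simp only [Complex.re_sum, r, Complex.re_ofReal_mul]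
  have h5 : normPow p S b ^ (1 / p) * normPow p S c ^ (1 - 1 / p) ≤
      (t + μ)⁻¹ * normPow p S c := by
    have h6 : normPow p S b ^ (1 / p) ≤ (t + μ)⁻¹ * normPow p S c ^ (1 / p) := by
      rw [inv_mul_eq_div, le_div_iff₀ (by positivity)]
      linarith
    have hpp : 0 ≤ 1 - 1 / p := by
      rw [sub_nonneg, div_le_one hp0]
      exact hp.le
    calc _ ≤ (t + μ)⁻¹ * normPow p S c ^ (1 / p) * normPow p S c ^ (1 - 1 / p) := by gcongr
      _ = _ := by
        rw [mul_assoc, ← Real.rpow_add_of_nonneg hB (by positivity) hpp, add_sub_cancel,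
          Real.rpow_one]
  simp only [sub_mul, Finset.sum_sub_distrib]
  rw [← Finset.mul_sum, ← normPow_eq_sum hp]
  linarith

lemma rpow_mul_normPow_le_energy {p s μ : ℝ} (hp : 1 < p) (hs : 0 < s) (hs2 : s ≤ 2) (hμ : 0 < μ)
    {S : Finset (Fin d → ℤ)} (h : ∀ c : (Fin d → ℤ) → ℂ, μ * normPow p S c ≤ energy p 2 S c)
    (c : (Fin d → ℤ) → ℂ) : μ ^ (s / 2) * normPow p S c ≤ energy p s S c := by
  rcases hs2.eq_or_lt with rfl | hs2
  · rw [div_self two_ne_zero, Real.rpow_one]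
    exact h c
  have hσ : s / 2 ∈ Set.Ioo (0 : ℝ) 1 := ⟨by linarith, by linarith⟩
  have hk : ∀ k : Fin d → ℤ, ‖freq k‖ ^ s = (‖freq k‖ ^ 2) ^ (s / 2) := fun k => by
    rw [← Real.rpow_two, ← Real.rpow_mul (norm_nonneg _), mul_div_cancel₀ _ two_ne_zero]
  rw [energy_eq_sum]
  simp_rw [hk]
  rw [Real.rpow_eq_const_mul_integral hσ hμ.le]
  have e : ∀ k : Fin d → ℤ, _ := fun k => Real.rpow_eq_const_mul_integral hσ (sq_nonneg ‖freq k‖)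
  simp_rw [e, mul_assoc]
  rw [← Finset.mul_sum]
  have hpos := Real.integral_rpowIntegrand₀₁_one_pos hσ
  gcongr
  simp_rw [← integral_mul_const]
  have hint : ∀ k ∈ S, IntegrableOn (fun t => Real.rpowIntegrand₀₁ (s / 2) t (‖freq k‖ ^ 2) *
      (pairCoeff p S c k).re) (Set.Ioi 0) := fun k _ =>
    (Real.integrableOn_rpowIntegrand₀₁_Ioi hσ (sq_nonneg ‖freq k‖)).mul_const _
  rw [← integral_finsetSum _ hint]
  refine setIntegral_mono_on ((Real.integrableOn_rpowIntegrand₀₁_Ioi hσ hμ.le).mul_const _)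
    (integrable_finsetSum _ hint) measurableSet_Ioi fun t ht => ?_
  have ht : 0 < t := ht
  have := mul_le_mul_of_nonneg_left (resolvent_le hp hμ h c ht) (Real.rpow_nonneg ht.le (s / 2))
  simp only [Real.rpowIntegrand₀₁, mul_assoc]
  rwa [← Finset.mul_sum]

lemma exists_mul_normPow_le_energy {p s : ℝ} (hp : 1 < p) (hs : 0 < s) (hs2 : s ≤ 2) (d : ℕ) :
    ∃ c₀ : ℝ, 0 < c₀ ∧ ∀ N : ℕ, 0 < N → ∀ S : Finset (Fin d → ℤ), InAnnulus N S →
      ∀ c : (Fin d → ℤ) → ℂ, c₀ * (N : ℝ) ^ s * normPow p S c ≤ energy p s S c := by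
  obtain ⟨c₀, hc₀, h⟩ := exists_mul_normPow_le_energy_two hp d
  refine ⟨c₀ ^ (s / 2), by positivity, fun N hN S hS c => ?_⟩
  have hN' : (0 : ℝ) < N := by exact_mod_cast hN
  have := rpow_mul_normPow_le_energy hp hs hs2 (by positivity) (h N hN S hS) c
  rwa [Real.mul_rpow hc₀.le (by positivity), ← Real.rpow_two, ← Real.rpow_mul hN'.le,
    mul_div_cancel₀ _ two_ne_zero] at this

/-- The coefficients of `e^{-tΛ^s} g` for `g = trigPoly S c`. -/
def heatCoeff (s : ℝ) (c : (Fin d → ℤ) → ℂ) (t : ℝ) (k : Fin d → ℤ) : ℂ :=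
  ((Real.exp (-t * ‖freq k‖ ^ s) : ℝ) : ℂ) * c k

lemma hasDerivAt_trigPoly_heatCoeff (s : ℝ) (S : Finset (Fin d → ℤ)) (c : (Fin d → ℤ) → ℂ)
    (x : UnitAddTorus (Fin d)) (t : ℝ) :
    HasDerivAt (fun t => trigPoly S (heatCoeff s c t) x)
      (-trigPoly S (fun k => ((‖freq k‖ ^ s : ℝ) : ℂ) * heatCoeff s c t k) x) t := by
  unfold trigPoly
  rw [← Finset.sum_neg_distrib]
  refine HasDerivAt.fun_sum fun k _ => ?_
  have h : HasDerivAt (fun t : ℝ => Real.exp (-t * ‖freq k‖ ^ s))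
      (Real.exp (-t * ‖freq k‖ ^ s) * (-‖freq k‖ ^ s)) t := by
    simpa using ((hasDerivAt_id t).neg.mul_const (‖freq k‖ ^ s)).exp
  have := (h.ofReal_comp.mul_const (c k)).mul_const (mFourier k x)
  refine HasDerivAt.congr_deriv this ?_
  simp only [heatCoeff]
  push_cast
  ring

lemma continuous_trigPoly_heatCoeff (s : ℝ) (S : Finset (Fin d → ℤ)) (b c : (Fin d → ℤ) → ℂ) :
    Continuous fun z : ℝ × UnitAddTorus (Fin d) =>
      trigPoly S (fun k => b k * heatCoeff s c z.1 k) z.2 := by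
  unfold trigPoly heatCoeff
  fun_prop

lemma hasDerivAt_norm_rpow_dualMap {p : ℝ} (hp : 1 < p) {u : ℝ → ℂ} {u' : ℂ} {t : ℝ}
    (hu : HasDerivAt u u' t) :
    HasDerivAt (fun t => ‖u t‖ ^ p) (p * (u' * dualMap p (u t)).re) t := by
  have := (hasFDerivAt_norm_rpow (u t) hp).comp_hasDerivAt t hu
  refine HasDerivAt.congr_deriv this ?_
  simp [dualMap, Complex.inner, Complex.mul_re]
  ring

lemma hasDerivAt_normPow {p : ℝ} (hp : 1 < p) (s : ℝ) (S : Finset (Fin d → ℤ))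
    (c : (Fin d → ℤ) → ℂ) (t : ℝ) :
    HasDerivAt (fun t => normPow p S (heatCoeff s c t)) (-p * energy p s S (heatCoeff s c t)) t := by
  have hp0 : 0 < p := by linarith
  have hJ := continuous_dualMap hp
  set F' : ℝ × UnitAddTorus (Fin d) → ℝ := fun z =>
    p * (-trigPoly S (fun k => ((‖freq k‖ ^ s : ℝ) : ℂ) * heatCoeff s c z.1 k) z.2 *
      dualMap p (trigPoly S (heatCoeff s c z.1) z.2)).re with hF'
  have hF'c : Continuous F' := by
    have h1 := continuous_trigPoly_heatCoeff s S (fun k => ((‖freq k‖ ^ s : ℝ) : ℂ)) c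
    have h2 := continuous_trigPoly_heatCoeff s S (fun _ => 1) c
    simp only [one_mul] at h2
    exact (Complex.continuous_re.comp (h1.neg.mul (hJ.comp h2))).const_mul p
  obtain ⟨K, hK⟩ := ((isCompact_closedBall t 1).prod
    (isCompact_univ (X := UnitAddTorus (Fin d)))).exists_bound_of_continuousOn hF'c.continuousOn
  have hcont : ∀ t', Continuous fun x => ‖trigPoly S (heatCoeff s c t') x‖ ^ p := fun t' =>
    (continuous_trigPoly S _).norm.rpow_const fun _ => Or.inr hp0.le
  have key := (hasDerivAt_integral_of_dominated_loc_of_deriv_le (μ := torusMeasure d)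
    (F := fun t x => ‖trigPoly S (heatCoeff s c t) x‖ ^ p) (F' := fun t x => F' (t, x))
    (bound := fun _ => K) (x₀ := t) (Metric.ball_mem_nhds t one_pos)
    (Eventually.of_forall fun t' => (hcont t').aestronglyMeasurable)
    (hcont t).integrable_of_compactSpace
    (hF'c.comp (Continuous.prodMk_right t)).aestronglyMeasurable
    (Eventually.of_forall fun x t' ht' =>
      hK (t', x) ⟨Metric.ball_subset_closedBall ht', Set.mem_univ x⟩)
    (integrable_const K)
    (Eventually.of_forall fun x t' _ =>
      hasDerivAt_norm_rpow_dualMap hp (hasDerivAt_trigPoly_heatCoeff s S c x t'))).2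
  refine HasDerivAt.congr_deriv key ?_
  have hre := integral_re (𝕜 := ℂ) (μ := torusMeasure d)
    (f := fun x => trigPoly S (fun k => ((‖freq k‖ ^ s : ℝ) : ℂ) * heatCoeff s c t k) x *
      dualMap p (trigPoly S (heatCoeff s c t) x))
    (((continuous_trigPoly S _).mul
      (hJ.comp (continuous_trigPoly S _))).integrable_of_compactSpace)
  simp only [RCLike.re_eq_complex_re] at hre
  simp only [hF', integral_const_mul, neg_mul, Complex.neg_re, integral_neg, hre]
  rw [integral_trigPoly_mul_dualMap hp, energy, mul_neg]

lemma normPow_heatCoeff_le {p s γ : ℝ} (hp : 1 < p) {S : Finset (Fin d → ℤ)}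
    (h : ∀ c : (Fin d → ℤ) → ℂ, γ * normPow p S c ≤ energy p s S c) (c : (Fin d → ℤ) → ℂ)
    {t : ℝ} (ht : 0 ≤ t) :
    normPow p S (heatCoeff s c t) ≤ Real.exp (-(p * γ * t)) * normPow p S c := by
  have hd : ∀ t, HasDerivAt (fun t => Real.exp (p * γ * t) * normPow p S (heatCoeff s c t))
      (Real.exp (p * γ * t) * (p * γ) * normPow p S (heatCoeff s c t) +
        Real.exp (p * γ * t) * (-p * energy p s S (heatCoeff s c t))) t := fun t => by
    refine HasDerivAt.mul ?_ (hasDerivAt_normPow hp s S c t)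
    simpa using ((hasDerivAt_id t).const_mul (p * γ)).exp
  have hanti : Antitone fun t => Real.exp (p * γ * t) * normPow p S (heatCoeff s c t) := by
    refine antitone_of_deriv_nonpos (fun t => (hd t).differentiableAt) fun t => ?_
    rw [(hd t).deriv]
    have h1 := mul_le_mul_of_nonneg_left (h (heatCoeff s c t))
      (by positivity : 0 ≤ Real.exp (p * γ * t) * p)
    linarith
  have h0 : heatCoeff s c 0 = c := by
    ext k
    simp [heatCoeff]
  have := hanti ht
  simp only [mul_zero, Real.exp_zero, one_mul, h0] at this
  rw [Real.exp_neg, inv_mul_eq_div, le_div_iff₀ (Real.exp_pos _)]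
  linarith

lemma mFourierCoeff_eq_integral_torusMeasure (f : UnitAddTorus (Fin d) → ℂ) (k : Fin d → ℤ) :
    mFourierCoeff f k = ∫ x, mFourier (-k) x * f x ∂(torusMeasure d) := rfl

lemma integral_mFourier [DecidableEq (Fin d → ℤ)] (k : Fin d → ℤ) :
    ∫ x, mFourier k x ∂(torusMeasure d) = if k = 0 then 1 else 0 := by
  split_ifs with hk
  · subst hk
    simp [mFourier_zero]
  · obtain ⟨i, hi⟩ := Function.ne_iff.1 hk
    set a := torusMk (EuclideanSpace.single i (1 / (2 * (k i : ℝ))))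
    have hki : (k i : ℝ) ≠ 0 := by exact_mod_cast hi
    have ha : mFourier k a = -1 := by
      rw [mFourier_torusMk_single, Real.fourierChar_apply,
        show 2 * Real.pi * (1 / (2 * (k i : ℝ)) * k i) = Real.pi by field_simp, Complex.exp_pi_mul_I]
    have h := integral_add_right_eq_self (μ := torusMeasure d) (fun x => mFourier k x) a
    simp only [mFourier_apply_add, integral_mul_const, ha] at h
    linear_combination (-1 / 2 : ℂ) * h

lemma mFourierCoeff_trigPoly [DecidableEq (Fin d → ℤ)] (S : Finset (Fin d → ℤ))
    (c : (Fin d → ℤ) → ℂ) (k : Fin d → ℤ) :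
    mFourierCoeff (trigPoly S c) k = if k ∈ S then c k else 0 := by
  rw [mFourierCoeff_eq_integral_torusMeasure]
  have e : ∀ x, mFourier (-k) x * trigPoly S c x = ∑ l ∈ S, c l * mFourier (-k + l) x :=
    fun x => by
      rw [trigPoly, Finset.mul_sum]
      refine Finset.sum_congr rfl fun l _ => ?_
      rw [mFourier_add]
      ring
  simp_rw [e]
  rw [integral_finsetSum _ fun l _ =>
    ((mFourier (-k + l)).continuous.const_mul (c l)).integrable_of_compactSpace]
  simp_rw [integral_const_mul, integral_mFourier, neg_add_eq_zero]
  simp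

lemma torusMultiplier_trigPoly (m : (Fin d → ℤ) → ℂ) (S : Finset (Fin d → ℤ))
    (c : (Fin d → ℤ) → ℂ) :
    torusMultiplier m (trigPoly S c) = trigPoly S fun k => m k * c k := by
  classical
  ext x
  rw [torusMultiplier, trigPoly, tsum_eq_sum (s := S)]
  · refine Finset.sum_congr rfl fun k hk => ?_
    rw [mFourierCoeff_trigPoly, if_pos hk]
  · intro k hk
    rw [mFourierCoeff_trigPoly, if_neg hk, mul_zero, zero_mul]

lemma finite_norm_freq_le (R : ℝ) : {k : Fin d → ℤ | ‖freq k‖ ≤ R}.Finite := by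
  refine (Set.Finite.pi' fun _ : Fin d => (Set.finite_Icc (-⌈R⌉) ⌈R⌉)).subset fun k hk i => ?_
  have h1 : |(k i : ℝ)| ≤ R := (PiLp.norm_apply_le (freq k) i).trans hk
  have h2 := abs_le.1 (h1.trans (Int.le_ceil R))
  exact ⟨by exact_mod_cast h2.1, by exact_mod_cast h2.2⟩

lemma exists_lpProj_eq_trigPoly {ψ : EuclideanSpace ℝ (Fin d) → ℝ} (hψ : IsLPCutoff ψ) {N : ℕ}
    (hN : 0 < N) (f : UnitAddTorus (Fin d) → ℂ) :
    ∃ S : Finset (Fin d → ℤ), InAnnulus N S ∧ ∃ c, lpProj ψ N f = trigPoly S c := by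
  have hN' : (0 : ℝ) < N := by exact_mod_cast hN
  have hfin : {k : Fin d → ℤ | (N : ℝ) ≤ ‖freq k‖ ∧ ‖freq k‖ ≤ 3 * N}.Finite :=
    (finite_norm_freq_le (3 * N)).subset fun k hk => hk.2
  refine ⟨hfin.toFinset, fun k hk => by simpa using hk, fun k =>
    ((ψ ((2 * (N : ℝ))⁻¹ • freq k) - ψ ((N : ℝ)⁻¹ • freq k) : ℝ) : ℂ) * mFourierCoeff f k,
    funext fun x => ?_⟩
  rw [lpProj, torusMultiplier, tsum_eq_sum (s := hfin.toFinset)]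
  · rfl
  · intro k hk
    have n1 : ‖(2 * (N : ℝ))⁻¹ • freq k‖ = ‖freq k‖ / (2 * N) := by
      rw [norm_smul, norm_inv, Real.norm_of_nonneg (by positivity), inv_mul_eq_div]
    have n2 : ‖(N : ℝ)⁻¹ • freq k‖ = ‖freq k‖ / N := by
      rw [norm_smul, norm_inv, Real.norm_of_nonneg (by positivity), inv_mul_eq_div]
    have : ψ ((2 * (N : ℝ))⁻¹ • freq k) = ψ ((N : ℝ)⁻¹ • freq k) := by
      rcases lt_or_ge ‖freq k‖ N with h | h
      · rw [hψ.eq_one _ (by rw [n1, div_le_one (by positivity)]; linarith),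
          hψ.eq_one _ (by rw [n2, div_le_one hN']; exact h.le)]
      · have h3 : 3 * (N : ℝ) < ‖freq k‖ := by
          by_contra! h'
          exact hk (by simpa using ⟨h, h'⟩)
        rw [hψ.eq_zero _ (by rw [n1, le_div_iff₀ (by positivity)]; linarith),
          hψ.eq_zero _ (by rw [n2, le_div_iff₀ hN']; linarith)]
    rw [this, sub_self, Complex.ofReal_zero, zero_mul, zero_mul]

lemma eLpNorm_trigPoly {p : ℝ} (hp : 1 < p) (S : Finset (Fin d → ℤ)) (c : (Fin d → ℤ) → ℂ) :
    eLpNorm (trigPoly S c) (ENNReal.ofReal p) (torusMeasure d) =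
      ENNReal.ofReal (normPow p S c ^ (1 / p)) := by
  have hp0 : 0 < p := by linarith
  rw [MemLp.eLpNorm_eq_integral_rpow_norm (by simpa using hp0) ENNReal.ofReal_ne_top,
    ENNReal.toReal_ofReal hp0.le, normPow, one_div]
  exact (continuous_trigPoly S c).memLp_of_hasCompactSupport (HasCompactSupport.of_compactSpace _)

end

theorem theorem4p7 (d : ℕ) (hd : 1 ≤ d) (s : ℝ) (hs0 : 0 < s) (hs2 : s ≤ 2)
    (p : ℝ) (hp : 1 < p) (ψ : EuclideanSpace ℝ (Fin d) → ℝ) (hψ : IsLPCutoff ψ) :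
    (∃ c : ℝ, 0 < c ∧
      ∀ f : UnitAddTorus (Fin d) → ℝ, TorusSmooth f → ∀ N : ℕ, 2 ≤ N → ∀ t : ℝ, 0 < t →
        eLpNorm (fracHeat s t (lpProj ψ N (fun x => (f x : ℂ)))) (ENNReal.ofReal p) (torusMeasure d)
          ≤ ENNReal.ofReal (Real.exp (-c * (N : ℝ) ^ s * t)) *
            eLpNorm (lpProj ψ N (fun x => (f x : ℂ))) (ENNReal.ofReal p) (torusMeasure d)) ∧
    (∃ c' : ℝ, 0 < c' ∧
      ∀ f : UnitAddTorus (Fin d) → ℝ, TorusSmooth f → ∀ N : ℕ, 2 ≤ N →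
        c' * (N : ℝ) ^ s *
            (eLpNorm (lpProj ψ N (fun x => (f x : ℂ))) (ENNReal.ofReal p) (torusMeasure d)).toReal ^ p
          ≤ (∫ x, fracLaplacian s (lpProj ψ N (fun y => (f y : ℂ))) x *
              ((‖lpProj ψ N (fun y => (f y : ℂ)) x‖ ^ (p - 2) : ℝ) : ℂ) *
              (starRingEnd ℂ) (lpProj ψ N (fun y => (f y : ℂ)) x) ∂(torusMeasure d)).re) := by
  have hp0 : 0 < p := by linarith
  obtain ⟨c₀, hc₀, h⟩ := exists_mul_normPow_le_energy hp hs0 hs2 d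
  refine ⟨⟨c₀, hc₀, fun f _ N hN t ht => ?_⟩, ⟨c₀, hc₀, fun f _ N hN => ?_⟩⟩
  · obtain ⟨S, hS, c, hc⟩ := exists_lpProj_eq_trigPoly hψ (by lia : 0 < N) fun x => (f x : ℂ)
    have hle := normPow_heatCoeff_le hp (h N (by lia) S hS) c ht.le
    have hheat : fracHeat s t (trigPoly S c) = trigPoly S (heatCoeff s c t) :=
      torusMultiplier_trigPoly _ S c
    rw [hc, hheat, eLpNorm_trigPoly hp, eLpNorm_trigPoly hp, ← ENNReal.ofReal_mul (Real.exp_nonneg _)]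
    refine ENNReal.ofReal_le_ofReal ((Real.rpow_le_rpow (normPow_nonneg _ _ _) hle
      (by positivity)).trans (le_of_eq ?_))
    rw [Real.mul_rpow (Real.exp_nonneg _) (normPow_nonneg _ _ _), ← Real.exp_mul]
    congr 2
    field_simp
  · obtain ⟨S, hS, c, hc⟩ := exists_lpProj_eq_trigPoly hψ (by lia : 0 < N) fun x => (f x : ℂ)
    have hlap : fracLaplacian s (trigPoly S c) =
        trigPoly S fun k => ((‖freq k‖ ^ s : ℝ) : ℂ) * c k := torusMultiplier_trigPoly _ S c
    have hpow : (ENNReal.ofReal (normPow p S c ^ (1 / p))).toReal ^ p = normPow p S c := by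
      rw [ENNReal.toReal_ofReal (Real.rpow_nonneg (normPow_nonneg _ _ _) _),
        ← Real.rpow_mul (normPow_nonneg _ _ _), one_div_mul_cancel hp0.ne', Real.rpow_one]
    rw [hc, hlap, eLpNorm_trigPoly hp, hpow]
    simp only [mul_assoc]
    have e := integral_trigPoly_mul_dualMap hp S (fun k => ((‖freq k‖ ^ s : ℝ) : ℂ)) c
    simp only [dualMap] at e
    rw [e, ← mul_assoc]
    exact h N (by lia) S hS c
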